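/- **Theorem.** Let $\Sigma$ be a finite, linearly ordered alphabet, and order $\Sigma^*$ by the radix (length-lexicographic) order: $u<v$ if $|u|<|v|$, or if $u=xay$ and $v=xbz$ with $|y|=|z|$, $a,b\in\Sigma$ and $a<b$. For $L\subseteq\Sigma^*$ and $u\in\Sigma^*$ (not necessarily in $L$), the *$L$-successor* of $u$ is the word $v\in L$ with $u<v$ such that no $w\in L$ satisfies $u<w<v$, if such a word exists. The word $u$ is *$L$-length-preserving* if it has an $L$-successor and this $L$-successor has length $|u|$; otherwise $u$ is *$L$-length-increasing*. A *finite-state transducer* is a nondeterministic finite automaton with one initial state whose transitions $p\xrightarrow{a\mid b}q$ read $a\in\Sigma\cup\{\varepsilon\}$ and write $b\in\Sigma\cup\{\varepsilon\}$. It is *unambiguous* if every input word has at most one accepting run, where a run is a sequence of transitions; it rejects an input without accepting run, and maps an input to the output written along its accepting run. There is a function $g:\mathbb N\to\mathbb R$ with $g(n)=O(\sqrt{n\log n})$ as $n\to\infty$, independent of $\Sigma$ and $L$, such that for every finite ordered alphabet $\Sigma$ and every language $L\subseteq\Sigma^*$ that is recognized by a (complete) DFA with $n$ states, there is an unambiguous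 finite-state transducer with at most $2^{g(n)}$ states that rejects all $L$-length-increasing words and maps every $L$-length-preserving word to its $L$-successor. -/

import Mathlib

open Asymptotics Filter

universe u v

/-- Strict radix (length-lexicographic) order on words over an ordered alphabet. -/
def RadixLT {α : Type*} [LT α] (x y : List α) : Prop :=
  List.Shortlex (· < ·) x y

/-- `y` is the `L`-successor of `x`: the smallest word of `L` that is strictly larger than `x` in
radix order. The word `x` itself need not belong to `L`. -/
def IsSuccessor {α : Type*} [LT α] (L : Language α) (x y : List α) : Prop :=
  y ∈ L ∧ RadixLT x y ∧ ∀ z : List α, RadixLT x z → RadixLT z y → z ∉ L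

/-- A word is `L`-maximal if it has no `L`-successor. -/
def IsMaximalWord {α : Type*} [LT α] (L : Language α) (x : List α) : Prop :=
  ¬ ∃ y, IsSuccessor L x y

/-- A word is `L`-length-preserving if it is not `L`-maximal and its `L`-successor has the same
length. -/
def IsLengthPreserving {α : Type*} [LT α] (L : Language α) (x : List α) : Prop :=
  ¬ IsMaximalWord L x ∧ ∀ y, IsSuccessor L x y → y.length = x.length

/-- Words that are not `L`-length-preserving (in particular, all `L`-maximal words). -/
def IsLengthIncreasing {α : Type*} [LT α] (L : Language α) (x : List α) : Prop :=
  ¬ IsLengthPreserving L x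

/-- A (nondeterministic) transducer with input alphabet `α`, output alphabet `β` and state set `σ`;
`(q, b) ∈ step p a` is the transition from `p` to `q` that reads `a` and writes `b`, where
`none` stands for the empty word, both as input and as output. -/
structure Transducer (α β σ : Type*) where
  step : σ → Option α → Set (σ × Option β)
  start : σ
  accept : Set σ

namespace Transducer

variable {α β σ : Type*}

/-- `T.IsPath p r q`: starting in state `p`, the sequence `r` of transitions, each given by its
input label, its output label and its target state, is a path of `T` that ends in `q`. -/
def IsPath (T : Transducer α β σ) : σ → List (Option α × Option β × σ) → σ → Prop
  | p, [], q => p = q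
  | p, t :: r, q => (t.2.2, t.2.1) ∈ T.step p t.1 ∧ T.IsPath t.2.2 r q

/-- The word read along a sequence of transitions. -/
def inputWord (r : List (Option α × Option β × σ)) : List α :=
  r.filterMap fun t => t.1

/-- The word written along a sequence of transitions. -/
def outputWord (r : List (Option α × Option β × σ)) : List β :=
  r.filterMap fun t => t.2.1

/-- `r` is an accepting run of `T` on the input `x`. -/
def IsAcceptingRun (T : Transducer α β σ) (x : List α)
    (r : List (Option α × Option β × σ)) : Prop :=
  (∃ q ∈ T.accept, T.IsPath T.start r q) ∧ inputWord r = x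

/-- `T` accepts the input `x` (with some output); otherwise it rejects `x`. -/
def Accepts (T : Transducer α β σ) (x : List α) : Prop :=
  ∃ r, T.IsAcceptingRun x r

/-- Some accepting run of `T` on the input `x` has the output `y`. -/
def Transduces (T : Transducer α β σ) (x : List α) (y : List β) : Prop :=
  ∃ r, T.IsAcceptingRun x r ∧ outputWord r = y

/-- Every input has at most one accepting run. -/
def Unambiguous (T : Transducer α β σ) : Prop :=
  ∀ x r s, T.IsAcceptingRun x r → T.IsAcceptingRun x s → r = s

end Transducer

/-! The successor `y` of a length-preserving word `x` copies a prefix of `x`, writes one larger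
letter, and continues with the least accepted completion; the split is correct when nothing accepted
lies above the rest of `x` or strictly between the two letters. Each of these conditions can be
tested letter by letter, once it is known from which states of the DFA some word as long as the
remaining input is accepted. For remaining length `k` this set is `coreach k`. The transducer
guesses it and checks the guesses backwards: `coreach (k + 1)` is determined by `coreach k`, and the
last set has to be `coreach 0`. So a run is determined by its input and output, and the output is
unique because the successor is.

The number of states is thus polynomial in `n` times the number of distinct sets `coreach k`. A walk
of length at least `n` meets a cycle, into which a closed walk of any sufficiently large length
divisible by the period can be inserted. Hence `coreach k ⊆ coreach (k + P)` for `k ≥ n` and `P = n²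
· lcm` of the periods (`reachIn_subset_add`), and each residue class mod `P` contributes at most `n
+ 1` sets (`card_range_le_of_subset_add`). The distinct nonzero periods have sum at most `n`
(`sum_walkPeriods_le`), so Landau's argument with Chebyshev's bound gives `lcm = 2^O(√(n log n))`.
-/

/-! ### Walks in a finite digraph -/

/-- `HasWalk r k x y`: there is a walk of length `k` from `x` to `y` in the digraph `r`. -/
def HasWalk {V : Type*} (r : V → V → Prop) : ℕ → V → V → Prop
  | 0, x, y => x = y
  | k + 1, x, y => ∃ z, r x z ∧ HasWalk r k z y

namespace HasWalk

variable {V : Type*} {r : V → V → Prop}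

theorem trans {a b : ℕ} {x y z : V} (h : HasWalk r a x y) (h' : HasWalk r b y z) :
    HasWalk r (a + b) x z := by
  induction a generalizing x with
  | zero => obtain rfl : x = y := h; simpa using h'
  | succ a ih =>
    obtain ⟨w, hw, hwy⟩ := h
    rw [Nat.succ_add]
    exact ⟨w, hw, ih hwy⟩

theorem exists_seq {k : ℕ} {x y : V} (h : HasWalk r k x y) :
    ∃ f : ℕ → V, f 0 = x ∧ f k = y ∧ ∀ i j, i ≤ j → j ≤ k → HasWalk r (j - i) (f i) (f j) := by
  induction k generalizing x with
  | zero =>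
    obtain rfl : x = y := h
    exact ⟨fun _ => x, rfl, rfl, fun i j hij hj => by
      obtain rfl : j = 0 := by omega
      obtain rfl : i = 0 := by omega
      exact rfl⟩
  | succ k ih =>
    obtain ⟨w, hw, hwy⟩ := h
    obtain ⟨f, hf0, hfk, hf⟩ := ih hwy
    refine ⟨fun i => Nat.casesOn i x f, rfl, hfk, fun i j hij hj => ?_⟩
    cases j with
    | zero =>
      obtain rfl : i = 0 := by omega
      exact rfl
    | succ j =>
      cases i with
      | zero => exact ⟨w, hw, by simpa [hf0] using hf 0 j (by omega) (by omega)⟩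
      | succ i => simpa using hf i j (by omega) (by omega)

/-- A walk with at least as many steps as there are vertices contains a short cycle. -/
theorem exists_cycle [Fintype V] {k : ℕ} {x y : V} (h : HasWalk r k x y)
    (hk : Fintype.card V ≤ k) :
    ∃ (z : V) (a b c : ℕ), a + b + c = k ∧ 0 < b ∧ b ≤ Fintype.card V ∧
      HasWalk r a x z ∧ HasWalk r b z z ∧ HasWalk r c z y := by
  obtain ⟨f, rfl, rfl, hf⟩ := h.exists_seq
  obtain ⟨i, j, hij, hfij⟩ := Fintype.exists_ne_map_eq_of_card_lt
    (fun i : Fin (Fintype.card V + 1) => f i) (by simp)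
  wlog hlt : i < j generalizing i j
  · exact this j i hij.symm hfij.symm (lt_of_le_of_ne (not_lt.mp hlt) hij.symm)
  have h1 : (i : ℕ) < j := hlt
  have h2 := j.isLt
  refine ⟨f i, i, j - i, k - j, by omega, by omega, by omega, ?_, ?_, ?_⟩
  · simpa using hf 0 i (by omega) (by omega)
  · have := hf i j (by omega) (by omega)
    rwa [← hfij] at this
  · rw [hfij]
    exact hf j k (by omega) le_rfl

/-- A long closed walk can be shortened without changing its length modulo `c`. -/
theorem exists_shorter [Fintype V] {c m : ℕ} (hc : 0 < c) {x : V} (h : HasWalk r m x x)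
    (hm : Fintype.card V * c ≤ m) : ∃ m', m' < m ∧ m' ≡ m [MOD c] ∧ HasWalk r m' x x := by
  obtain ⟨f, hf0, hfm, hf⟩ := h.exists_seq
  -- Pigeonhole on pairs (vertex, index mod `c`): the segment between two equal pairs is closed and
  -- its length is divisible by `c`, so it can be cut out.
  obtain ⟨i, j, hij, hfij⟩ := Fintype.exists_ne_map_eq_of_card_lt
    (fun i : Fin (m + 1) => ((f i, ⟨i % c, Nat.mod_lt _ hc⟩) : V × Fin c))
    (by simpa using Nat.lt_succ_of_le hm)
  wlog hlt : i < j generalizing i j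
  · exact this j i hij.symm hfij.symm (lt_of_le_of_ne (not_lt.mp hlt) hij.symm)
  have h1 : (i : ℕ) < j := hlt
  have h2 := j.isLt
  simp only [Prod.mk.injEq, Fin.mk.injEq] at hfij
  obtain ⟨hfe, hmod⟩ := hfij
  have w1 := hf 0 i (by omega) (by omega)
  have w2 := hf j m (by omega) le_rfl
  rw [hf0] at w1
  rw [hfm, ← hfe] at w2
  refine ⟨i - 0 + (m - j), by omega, ?_, w1.trans w2⟩
  have h3 : i - 0 + (m - j) + j ≡ m + j [MOD c] := by
    have : (i : ℕ) - 0 + (m - j) + j = m + i := by omega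
    rw [this]
    exact Nat.ModEq.add_left _ hmod
  exact Nat.ModEq.add_right_cancel' _ h3

theorem mul_length {c : ℕ} {x : V} (h : HasWalk r c x x) (t : ℕ) : HasWalk r (t * c) x x := by
  induction t with
  | zero => rw [Nat.zero_mul]; exact rfl
  | succ t ih => rw [Nat.succ_mul]; exact ih.trans h

/-- A walk that is too short is padded with the closed walk of length `c`. One that is too long is
shortened; the lower bound on `k` makes this possible as long as `m > k`. -/
theorem of_modEq [Fintype V] {c m k : ℕ} (hc : 0 < c) {x : V} (hcx : HasWalk r c x x)
    (h : HasWalk r m x x) (hmk : m ≡ k [MOD c]) (hk : Fintype.card V * c ≤ k) :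
    HasWalk r k x x := by
  induction m using Nat.strong_induction_on with
  | _ m ih =>
    rcases le_or_gt m k with hle | hgt
    · obtain ⟨t, ht⟩ := (Nat.modEq_iff_dvd' hle).mp hmk
      have : k = m + t * c := by rw [Nat.mul_comm t c, ← ht]; omega
      rw [this]
      exact h.trans (hcx.mul_length t)
    · obtain ⟨m', hlt, hmod, hw⟩ := h.exists_shorter hc (hk.trans hgt.le)
      exact ih m' hlt hw (hmod.trans hmk)

end HasWalk

/-! ### Periods of vertices and inclusions between the sets `reachIn` -/

section Period

variable {V : Type*} (r : V → V → Prop)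

/-- The monoid of lengths of closed walks at `x`. -/
def closedWalkLengths (x : V) : AddSubmonoid ℕ where
  carrier := {k | HasWalk r k x x}
  zero_mem' := rfl
  add_mem' := HasWalk.trans

/-- The gcd of the lengths of all closed walks at `x`. -/
noncomputable def walkPeriod (x : V) : ℕ := Nat.setGcd (closedWalkLengths r x : Set ℕ)

variable {r}

theorem walkPeriod_dvd {x : V} {k : ℕ} (h : HasWalk r k x x) : walkPeriod r x ∣ k :=
  Nat.setGcd_dvd_of_mem (s := (closedWalkLengths r x : Set ℕ)) h

/-- All large multiples of the gcd of a numerical monoid belong to it; `of_modEq` then descends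
modulo `c` to the explicit threshold. -/
theorem hasWalk_of_walkPeriod_dvd [Fintype V] {x : V} {c k : ℕ} (hc : 0 < c)
    (hcx : HasWalk r c x x) (hdvd : walkPeriod r x ∣ k) (hk : Fintype.card V * c ≤ k) :
    HasWalk r k x x := by
  obtain ⟨N, hN⟩ := Nat.exists_mem_closure_of_ge (closedWalkLengths r x : Set ℕ)
  rw [AddSubmonoid.closure_eq] at hN
  have hw : HasWalk r (k + N * c) x x :=
    hN (k + N * c) ((Nat.le_mul_of_pos_right N hc).trans (Nat.le_add_left _ _))
      (hdvd.add ((walkPeriod_dvd hcx).mul_left N))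
  exact HasWalk.of_modEq hc hcx hw (by simp [Nat.ModEq]) hk

/-- By symmetry, the period is constant on strongly connected components. -/
theorem walkPeriod_dvd_of_hasWalk {x y : V} {a b : ℕ} (hxy : HasWalk r a x y)
    (hyx : HasWalk r b y x) : walkPeriod r x ∣ walkPeriod r y := by
  refine Nat.dvd_setGcd_iff.mpr fun k hk => ?_
  have h1 := walkPeriod_dvd (hxy.trans hyx)
  have h2 := walkPeriod_dvd ((hxy.trans (show HasWalk r k y y from hk)).trans hyx)
  have h3 : a + k + b = a + b + k := by omega
  rw [h3] at h2
  exact (Nat.dvd_add_right h1).mp h2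

/-- Let `d` be the period and take a closed walk at `x` of length at least `d`. Its first `d`
vertices have period `d`, and they are distinct: bypassing the segment between two equal ones shows
that `d` divides the difference of their indices. -/
theorem walkPeriod_le_card_fiber [Fintype V] (x : V) :
    walkPeriod r x ≤ (Finset.univ.filter fun y => walkPeriod r y = walkPeriod r x).card := by
  classical
  rcases Nat.eq_zero_or_pos (walkPeriod r x) with h0 | hpos
  · rw [h0]; exact Nat.zero_le _
  obtain ⟨L, hL, hL0⟩ := Nat.exists_ne_zero_of_setGcd_ne_zero hpos.ne'
  have hLx : HasWalk r L x x := hL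
  have hle : walkPeriod r x ≤ L := Nat.le_of_dvd (Nat.pos_of_ne_zero hL0) (walkPeriod_dvd hLx)
  obtain ⟨f, hf0, hfL, hf⟩ := hLx.exists_seq
  have hto : ∀ i ≤ L, HasWalk r i x (f i) := fun i hi => by
    simpa [hf0] using hf 0 i (by omega) hi
  have hfrom : ∀ i ≤ L, HasWalk r (L - i) (f i) x := fun i hi => by
    simpa [hfL] using hf i L hi le_rfl
  rw [← Finset.card_range (walkPeriod r x)]
  refine Finset.card_le_card_of_injOn f (fun i hi => ?_) (fun i hi j hj hij => ?_)
  · have hi' : i ≤ L := (Finset.mem_range.mp (by simpa using hi)).le.trans hle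
    simpa using Nat.dvd_antisymm (walkPeriod_dvd_of_hasWalk (hfrom i hi') (hto i hi'))
      (walkPeriod_dvd_of_hasWalk (hto i hi') (hfrom i hi'))
  · have key : ∀ i j, i < walkPeriod r x → j < walkPeriod r x → f i = f j → ¬ i < j := by
      intro i j hi hj hij hlt
      have hw := (hto i (by omega)).trans (hij ▸ hfrom j (by omega))
      have h1 := walkPeriod_dvd hw
      have h2 := (Nat.dvd_sub (walkPeriod_dvd hLx) h1)
      have h3 : L - (i + (L - j)) = j - i := by omega
      rw [h3] at h2
      have := Nat.le_of_dvd (by omega) h2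
      omega
    simp only [Finset.coe_range, Set.mem_Iio] at hi hj
    have h1 := key i j hi hj hij
    have h2 := key j i hj hi hij.symm
    omega

variable (r)

/-- The nonzero periods of the vertices of a finite digraph. -/
noncomputable def walkPeriods [Fintype V] : Finset ℕ := (Finset.univ.image (walkPeriod r)).erase 0

/-- The fibers of `walkPeriod` over distinct periods are disjoint. -/
theorem sum_walkPeriods_le [Fintype V] : ∑ d ∈ walkPeriods r, d ≤ Fintype.card V := by
  classical
  calc ∑ d ∈ walkPeriods r, d
      ≤ ∑ d ∈ walkPeriods r, (Finset.univ.filter fun y => walkPeriod r y = d).card := by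
        refine Finset.sum_le_sum fun d hd => ?_
        obtain ⟨x, -, rfl⟩ := Finset.mem_image.mp (Finset.mem_of_mem_erase hd)
        exact walkPeriod_le_card_fiber x
    _ = (Finset.univ.filter fun y => walkPeriod r y ∈ walkPeriods r).card :=
        (Finset.card_eq_sum_card_fiberwise (f := walkPeriod r) (t := walkPeriods r)
          (fun y hy => by simpa using hy)).trans (Finset.sum_congr rfl fun d hd => by
            congr 1; ext y; simp only [Finset.mem_filter, Finset.mem_univ, true_and]
            exact ⟨fun h => h.2, fun h => ⟨h ▸ hd, h⟩⟩) |>.symm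
    _ ≤ Fintype.card V := Finset.card_le_univ _

/-- The vertices with a walk of length `k` into `F`. -/
def reachIn (F : Set V) (k : ℕ) : Set V := {x | ∃ y ∈ F, HasWalk r k x y}

theorem reachIn_subset_add [Fintype V] (F : Set V) {k P : ℕ} (hk : Fintype.card V ≤ k)
    (hP : Fintype.card V * Fintype.card V ≤ P) (hdvd : (walkPeriods r).lcm id ∣ P) :
    reachIn r F k ⊆ reachIn r F (k + P) := by
  rintro x ⟨y, hy, hxy⟩
  obtain ⟨z, a, b, c, habc, hb, hbn, h1, h2, h3⟩ := hxy.exists_cycle hk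
  have hz : walkPeriod r z ∈ walkPeriods r := by
    refine Finset.mem_erase.mpr ⟨fun h => ?_, Finset.mem_image_of_mem _ (Finset.mem_univ z)⟩
    have := walkPeriod_dvd h2
    rw [h, Nat.zero_dvd] at this
    omega
  -- As `z` lies on a cycle of length `b ≤ n`, the threshold `n * b` is at most `n * n`, whatever
  -- the period of `z`.
  have hw : HasWalk r P z z := hasWalk_of_walkPeriod_dvd hb h2
    ((Finset.dvd_lcm (f := id) hz).trans hdvd) ((Nat.mul_le_mul_left _ hbn).trans hP)
  have := ((h1.trans h2).trans hw).trans h3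
  exact ⟨y, hy, by convert this using 1; omega⟩

end Period

/-- A sequence of subsets of a finite type that increases along arithmetic progressions with
difference `P`, from the index `N` on, has few distinct members. -/
theorem card_range_le_of_subset_add {V : Type*} [Fintype V] (R : ℕ → Set V) {N P : ℕ}
    (hP : 0 < P) (hR : ∀ k, N ≤ k → R k ⊆ R (k + P)) :
    Nat.card (Set.range R) ≤ N + P * (Fintype.card V + 1) := by
  classical
  have hmono : ∀ k t, N ≤ k → R k ⊆ R (k + P * t) := by
    intro k t hk
    induction t with
    | zero => simp
    | succ t ih =>
      refine ih.trans ?_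
      have := hR (k + P * t) (by omega)
      rwa [Nat.add_assoc, ← Nat.mul_succ] at this
  have hle : ∀ k l, N ≤ k → k ≤ l → k ≡ l [MOD P] → R k ⊆ R l := by
    intro k l hk hkl hmod
    obtain ⟨t, ht⟩ := (Nat.modEq_iff_dvd' hkl).mp hmod
    have := hmono k t hk
    rwa [← ht, Nat.add_sub_cancel' hkl] at this
  have heq : ∀ k l, N ≤ k → k ≤ l → k ≡ l [MOD P] → (R k).ncard = (R l).ncard → R k = R l :=
    fun k l hk hkl hmod hcard => Set.eq_of_subset_of_ncard_le (hle k l hk hkl hmod) hcard.ge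
  choose idx hidx using fun S : Set.range R => S.2
  let φ : Set.range R → Fin N ⊕ (Fin P × Fin (Fintype.card V + 1)) := fun S =>
    if h : idx S < N then Sum.inl ⟨idx S, h⟩
    else Sum.inr (⟨idx S % P, Nat.mod_lt _ hP⟩, ⟨(R (idx S)).ncard, Nat.lt_succ_of_le (by
      rw [← Nat.card_eq_fintype_card]; exact Set.ncard_le_card _)⟩)
  -- Beyond `N`, sets with indices in the same residue class are comparable by inclusion, so equal
  -- cardinality forces equality.
  have hφ : Function.Injective φ := by
    intro S S' h
    have hS : R (idx S) = R (idx S') := by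
      simp only [φ] at h
      split_ifs at h with h1 h2 h2
      · simp only [Sum.inl.injEq, Fin.mk.injEq] at h
        rw [h]
      · simp only [Sum.inr.injEq, Prod.mk.injEq, Fin.mk.injEq] at h
        rcases le_total (idx S) (idx S') with hl | hl
        · exact heq _ _ (by omega) hl h.1 h.2
        · exact (heq _ _ (by omega) hl h.1.symm h.2.symm).symm
    rw [hidx, hidx] at hS
    exact Subtype.ext hS
  have := Nat.card_le_card_of_injective φ hφ
  simpa using this

theorem card_range_reachIn_le {V : Type*} [Fintype V] [Nonempty V] (r : V → V → Prop) (F : Set V) :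
    Nat.card (Set.range (reachIn r F)) ≤ Fintype.card V +
      Fintype.card V * Fintype.card V * (walkPeriods r).lcm id * (Fintype.card V + 1) := by
  have hlcm : 0 < (walkPeriods r).lcm id := Nat.pos_of_ne_zero fun h => by
    obtain ⟨d, hd, hd0⟩ := Finset.lcm_eq_zero_iff.mp h
    exact Finset.ne_of_mem_erase hd hd0
  exact card_range_le_of_subset_add _ (Nat.mul_pos (Nat.mul_pos Fintype.card_pos Fintype.card_pos)
    hlcm) fun k hk => reachIn_subset_add r F hk (Nat.le_mul_of_pos_right _ hlcm)
      (Nat.dvd_mul_left _ _)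

/-! ### Landau's bound for least common multiples -/

/-- For integers that are at least 2, the sum is at most the product. -/
theorem Nat.sum_primeFactors_le (d : ℕ) (hd : d ≠ 0) : ∑ p ∈ d.primeFactors, p ≤ d := by
  have key : ∀ s : Finset ℕ, (∀ p ∈ s, 2 ≤ p) → ∑ p ∈ s, p ≤ ∏ p ∈ s, p := by
    intro s
    induction s using Finset.induction_on with
    | empty => simp
    | insert p s hp ih =>
      intro h
      rw [Finset.sum_insert hp, Finset.prod_insert hp]
      have h1 := ih fun q hq => h q (Finset.mem_insert_of_mem hq)
      have h2 := h p (Finset.mem_insert_self _ _)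
      rcases s.eq_empty_or_nonempty with rfl | ⟨q, hq⟩
      · simp
      · have h3 : 2 ≤ ∏ q ∈ s, q := (h q (Finset.mem_insert_of_mem hq)).trans <|
          Nat.le_of_dvd (Finset.prod_pos fun q hq =>
            two_pos.trans_le (h q (Finset.mem_insert_of_mem hq)))
            (Finset.dvd_prod_of_mem _ hq)
        nlinarith
  exact (key _ fun p hp => (Nat.prime_of_mem_primeFactors hp).two_le).trans
    (Nat.le_of_dvd (Nat.pos_of_ne_zero hd) (Nat.prod_primeFactors_dvd d))

theorem Nat.le_pow_card_primeFactors {m n : ℕ} (hm : m ≠ 0)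
    (h : ∀ p ∈ m.primeFactors, p ^ m.factorization p ≤ n) : m ≤ n ^ m.primeFactors.card := by
  conv_lhs => rw [← Nat.prod_factorization_pow_eq_self hm]
  exact Finset.prod_le_pow_card _ _ _ h

section Landau

variable {D : Finset ℕ} {n : ℕ}

theorem lcm_ne_zero_of_zero_notMem (h0 : 0 ∉ D) : D.lcm id ≠ 0 := fun h => by
  obtain ⟨d, hd, hd0⟩ := Finset.lcm_eq_zero_iff.mp h
  exact h0 (by simpa using (show d = 0 from hd0) ▸ hd)

theorem Nat.Prime.pow_dvd_lcm_pair {p k a b : ℕ} (hp : p.Prime) :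
    p ^ k ∣ Nat.lcm a b ↔ p ^ k ∣ a ∨ p ^ k ∣ b := by
  rcases eq_or_ne a 0 with rfl | ha
  · simp
  rcases eq_or_ne b 0 with rfl | hb
  · simp
  rw [hp.pow_dvd_iff_le_factorization ha, hp.pow_dvd_iff_le_factorization hb,
    hp.pow_dvd_iff_le_factorization (Nat.lcm_ne_zero ha hb), Nat.factorization_lcm ha hb,
    Finsupp.sup_apply, le_sup_iff]

theorem Nat.Prime.pow_dvd_lcm_iff {p k : ℕ} (hp : p.Prime) (hk : k ≠ 0) :
    p ^ k ∣ D.lcm id ↔ ∃ d ∈ D, p ^ k ∣ d := by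
  induction D using Finset.induction_on with
  | empty => simp [hp.one_lt.ne', hk]
  | insert d D hd ih =>
    rw [Finset.lcm_insert, Finset.exists_mem_insert, ← ih]
    exact hp.pow_dvd_lcm_pair

theorem Finset.sum_biUnion_le_sum {ι κ : Type*} [DecidableEq ι] [DecidableEq κ] (s : Finset ι)
    (t : ι → Finset κ) (f : κ → ℕ) : ∑ p ∈ s.biUnion t, f p ≤ ∑ i ∈ s, ∑ p ∈ t i, f p := by
  induction s using Finset.induction_on with
  | empty => simp
  | insert i s hi ih =>
    rw [Finset.biUnion_insert, Finset.sum_insert hi]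
    have := Finset.sum_union_inter (s₁ := t i) (s₂ := s.biUnion t) (f := f)
    omega

theorem primeFactors_lcm_subset (h0 : 0 ∉ D) :
    (D.lcm id).primeFactors ⊆ D.biUnion Nat.primeFactors := fun p hp => by
  have hpp := Nat.prime_of_mem_primeFactors hp
  obtain ⟨d, hd, hpd⟩ := (hpp.pow_dvd_lcm_iff one_ne_zero).mp
    ((pow_one p).symm ▸ Nat.dvd_of_mem_primeFactors hp)
  exact Finset.mem_biUnion.mpr ⟨d, hd, Nat.mem_primeFactors.mpr
    ⟨hpp, by simpa using hpd, fun h => h0 (h ▸ hd)⟩⟩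

theorem sum_primeFactors_lcm_le (h0 : 0 ∉ D) : ∑ p ∈ (D.lcm id).primeFactors, p ≤ ∑ d ∈ D, d :=
  calc ∑ p ∈ (D.lcm id).primeFactors, p
      ≤ ∑ p ∈ D.biUnion Nat.primeFactors, p := Finset.sum_le_sum_of_subset
        (primeFactors_lcm_subset h0)
    _ ≤ ∑ d ∈ D, ∑ p ∈ d.primeFactors, p := by
        exact Finset.sum_biUnion_le_sum D Nat.primeFactors fun p => p
    _ ≤ ∑ d ∈ D, d := Finset.sum_le_sum fun d hd =>
        Nat.sum_primeFactors_le d fun h => h0 (h ▸ hd)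

/-- Every prime power dividing the lcm already divides a member of `D`, hence is at most `n`. -/
theorem lcm_le_pow_card_primeFactors (h0 : 0 ∉ D) (hD : ∑ d ∈ D, d ≤ n) :
    D.lcm id ≤ n ^ (D.lcm id).primeFactors.card := by
  have hne := lcm_ne_zero_of_zero_notMem h0
  refine Nat.le_pow_card_primeFactors hne fun p hp => ?_
  have hpp := Nat.prime_of_mem_primeFactors hp
  have hk : (D.lcm id).factorization p ≠ 0 :=
    (hpp.factorization_pos_of_dvd hne (Nat.dvd_of_mem_primeFactors hp)).ne'
  obtain ⟨d, hd, hpd⟩ := (hpp.pow_dvd_lcm_iff hk).mp (Nat.ordProj_dvd _ _)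
  exact (Nat.le_of_dvd (Nat.pos_of_ne_zero fun h => h0 (h ▸ hd)) hpd).trans
    ((Finset.single_le_sum (f := fun d => d) (fun _ _ => Nat.zero_le _) hd).trans hD)

/-- Split at `T`: at most `π(T)` primes are small, and fewer than `n / T` or exactly as many can be
large, since each contributes at least `T` to the sum. -/
theorem card_le_primeCounting_add {s : Finset ℕ} (hs : ∀ p ∈ s, p.Prime) (hn : ∑ p ∈ s, p ≤ n)
    {T : ℝ} (hT : 0 < T) : (s.card : ℝ) ≤ Nat.primeCounting ⌊T⌋₊ + n / T := by
  rw [← Finset.card_filter_add_card_filter_not (s := s) (fun p => p ≤ ⌊T⌋₊), Nat.cast_add]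
  refine add_le_add ?_ ?_
  · rw [← Nat.primesLE_card_eq_primeCounting]
    exact_mod_cast Finset.card_le_card fun p hp => by
      rw [Finset.mem_filter] at hp
      exact Nat.mem_primesLE.mpr ⟨hp.2, hs p hp.1⟩
  · rw [le_div_iff₀ hT]
    calc ((s.filter fun p => ¬ p ≤ ⌊T⌋₊).card : ℝ) * T
        = ∑ p ∈ s.filter (fun p => ¬ p ≤ ⌊T⌋₊), T := by simp
      _ ≤ ∑ p ∈ s.filter (fun p => ¬ p ≤ ⌊T⌋₊), (p : ℝ) := Finset.sum_le_sum fun p hp =>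
          (Nat.lt_of_floor_lt (not_le.mp (Finset.mem_filter.mp hp).2)).le
      _ ≤ ∑ p ∈ s, (p : ℝ) := Finset.sum_le_sum_of_subset_of_nonneg (Finset.filter_subset _ _)
          fun _ _ _ => Nat.cast_nonneg _
      _ ≤ n := by rw [← Nat.cast_sum]; exact_mod_cast hn

/-- The exponent of `n` in the bound on Landau's function. -/
noncomputable def landauExponent (n : ℕ) : ℝ :=
  Nat.primeCounting ⌊√((n : ℝ) * Real.log n)⌋₊ + n / √((n : ℝ) * Real.log n)

theorem lcm_le_rpow_landauExponent (h0 : 0 ∉ D) (hD : ∑ d ∈ D, d ≤ n) (hn : 1 ≤ n) :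
    ((D.lcm id : ℕ) : ℝ) ≤ (n : ℝ) ^ landauExponent n := by
  have h1 : ((D.lcm id : ℕ) : ℝ) ≤ (n : ℝ) ^ ((D.lcm id).primeFactors.card : ℝ) := by
    rw [Real.rpow_natCast]
    exact_mod_cast lcm_le_pow_card_primeFactors h0 hD
  -- For `n = 1` the threshold `√(n log n)` is 0, so the splitting argument does not apply, but the
  -- base 1 makes the exponent irrelevant.
  rcases hn.eq_or_lt with rfl | hn
  · simpa using h1
  have hn' : (1 : ℝ) < n := by exact_mod_cast hn
  have hT : 0 < √((n : ℝ) * Real.log n) :=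
    Real.sqrt_pos.mpr (mul_pos (by linarith) (Real.log_pos hn'))
  exact h1.trans (Real.rpow_le_rpow_of_exponent_le hn'.le (card_le_primeCounting_add
    (fun p hp => Nat.prime_of_mem_primeFactors hp) ((sum_primeFactors_lcm_le h0).trans hD) hT))

end Landau

/-! ### Asymptotics of the exponent and the count of states -/

theorem tendsto_sqrt_mul_log_atTop :
    Tendsto (fun n : ℕ => √((n : ℝ) * Real.log n)) atTop atTop :=
  Real.tendsto_sqrt_atTop.comp ((tendsto_natCast_atTop_atTop (R := ℝ)).atTop_mul_atTop₀
    (Real.tendsto_log_atTop.comp tendsto_natCast_atTop_atTop))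

theorem log_isBigO_sqrt_mul_log :
    (fun n : ℕ => Real.log n) =O[atTop] fun n : ℕ => √((n : ℝ) * Real.log n) := by
  refine IsBigO.of_bound 1 ?_
  filter_upwards [eventually_ge_atTop 1] with n hn
  have hn' : (1 : ℝ) ≤ n := by exact_mod_cast hn
  have h0 := Real.log_nonneg hn'
  rw [Real.norm_of_nonneg h0, Real.norm_of_nonneg (Real.sqrt_nonneg _), one_mul]
  refine Real.le_sqrt_of_sq_le ?_
  rw [sq]
  exact mul_le_mul_of_nonneg_right (Real.log_le_self (by linarith)) h0

theorem landauExponent_mul_log_isBigO :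
    (fun n : ℕ => landauExponent n * Real.log n) =O[atTop]
      fun n : ℕ => √((n : ℝ) * Real.log n) := by
  refine IsBigO.of_bound (2 * (Real.log 4 + 1) + 1) ?_
  filter_upwards [tendsto_sqrt_mul_log_atTop.eventually
    (Chebyshev.eventually_primeCounting_le one_pos), eventually_ge_atTop 3] with n hpi hn
  have hn' : (3 : ℝ) ≤ n := by exact_mod_cast hn
  have hlog : 1 ≤ Real.log n := by
    rw [Real.le_log_iff_exp_le (by linarith)]
    exact Real.exp_one_lt_three.le.trans hn'
  set T := √((n : ℝ) * Real.log n) with hT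
  have hT2 : T * T = n * Real.log n := Real.mul_self_sqrt (by positivity)
  have hT0 : 0 < T := Real.sqrt_pos.mpr (by positivity)
  -- This trades the denominator `log T` of Chebyshev's bound for `log n`, at the cost of the factor
  -- 2 in the constant. The final `+ 1` pays for `n log n / T = T`.
  have hlogT : Real.log n / 2 ≤ Real.log T := by
    rw [hT, Real.log_sqrt (by positivity), Real.log_mul (by positivity) (by positivity)]
    linarith [Real.log_nonneg hlog]
  have hlogT0 : 0 < Real.log T := by linarith
  have hnonneg : 0 ≤ landauExponent n := by unfold landauExponent; positivity
  rw [Real.norm_of_nonneg (by positivity), Real.norm_of_nonneg hT0.le, landauExponent, ← hT,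
    add_mul, add_mul, one_mul]
  refine add_le_add ?_ (le_of_eq ?_)
  · calc (Nat.primeCounting ⌊T⌋₊ : ℝ) * Real.log n
        ≤ (Real.log 4 + 1) * T / Real.log T * (2 * Real.log T) :=
          mul_le_mul hpi (by linarith) (by linarith) (by positivity)
      _ = 2 * (Real.log 4 + 1) * T := by field_simp
  · rw [div_mul_eq_mul_div, ← hT2, mul_div_assoc, div_self hT0.ne', mul_one]

/-- The binary logarithm of the bound on the number of states. -/
noncomputable def stateExponent (n : ℕ) : ℝ :=
  Real.logb 2 7 + 5 * Real.logb 2 n + landauExponent n * Real.logb 2 n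

theorem stateExponent_isBigO :
    stateExponent =O[atTop] fun n : ℕ => √((n : ℝ) * Real.log n) := by
  have h1 : (fun _ : ℕ => Real.logb 2 7) =O[atTop] fun n : ℕ => √((n : ℝ) * Real.log n) :=
    (isLittleO_const_left.mpr (Or.inr (tendsto_norm_atTop_atTop.comp
      tendsto_sqrt_mul_log_atTop))).isBigO
  have h2 := log_isBigO_sqrt_mul_log.const_mul_left (5 / Real.log 2)
  have h3 := landauExponent_mul_log_isBigO.const_mul_left (1 / Real.log 2)
  refine ((h1.add h2).add h3).congr_left fun n => ?_
  simp only [stateExponent, Real.logb]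
  ring

theorem two_rpow_stateExponent {n : ℕ} (hn : 1 ≤ n) :
    (2 : ℝ) ^ stateExponent n = 7 * (n : ℝ) ^ 5 * (n : ℝ) ^ landauExponent n := by
  have hn' : (0 : ℝ) < n := by exact_mod_cast hn
  have h (x : ℝ) : (2 : ℝ) ^ (x * Real.logb 2 n) = (n : ℝ) ^ x := by
    rw [mul_comm, Real.rpow_mul two_pos.le, Real.rpow_logb two_pos (by norm_num) hn']
  rw [stateExponent, Real.rpow_add two_pos, Real.rpow_add two_pos, h, h,
    Real.rpow_logb two_pos (by norm_num) (by norm_num)]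
  norm_cast

theorem card_states_le {V : Type*} [Fintype V] [Nonempty V] (r : V → V → Prop) (F : Set V) :
    ((1 + Fintype.card V * ((1 + Fintype.card V) * Nat.card (Set.range (reachIn r F))) : ℕ) : ℝ) ≤
      (2 : ℝ) ^ stateExponent (Fintype.card V) := by
  have hn : 1 ≤ Fintype.card V := Fintype.card_pos
  have h0 : 0 ∉ walkPeriods r := by simp [walkPeriods]
  have hl := lcm_le_rpow_landauExponent h0 (sum_walkPeriods_le r) hn
  have h1 : 1 ≤ (walkPeriods r).lcm id := Nat.pos_of_ne_zero (lcm_ne_zero_of_zero_notMem h0)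
  have hc := card_range_reachIn_le r F
  rw [two_rpow_stateExponent hn]
  refine le_trans ?_ (mul_le_mul_of_nonneg_left hl (by positivity))
  norm_cast
  generalize Nat.card (Set.range (reachIn r F)) = N at *
  generalize (walkPeriods r).lcm id = l at *
  generalize Fintype.card V = n at *
  -- The total is then at most `1 + n · 2n · 3n³l ≤ 7n⁵l`, which explains the constants in
  -- `stateExponent`.
  have h2 : N ≤ 3 * n ^ 3 * l := by
    have : n * 1 * 1 ≤ n ^ 3 * l := Nat.mul_le_mul (by nlinarith [Nat.pow_le_pow_left hn 2]) h1
    have : n * n * l * (n + 1) ≤ n * n * l * (2 * n) := Nat.mul_le_mul_left _ (by omega)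
    nlinarith
  have h3 : n * ((1 + n) * N) ≤ n * ((2 * n) * (3 * n ^ 3 * l)) := by gcongr; omega
  have h4 : 1 ≤ n ^ 5 * l := Nat.mul_pos (Nat.pow_pos hn) h1
  nlinarith

/-! ### Radix order on words of equal length -/

theorem radixLT_cons_cons {α : Type*} [LinearOrder α] {a b : α} {x y : List α}
    (h : y.length = x.length) :
    RadixLT (a :: x) (b :: y) ↔ a < b ∨ a = b ∧ RadixLT x y := by
  simp only [RadixLT]
  rw [List.shortlex_iff_lex (by simp [h]), List.shortlex_iff_lex h.symm, List.cons_lex_cons_iff]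

theorem radixLT_irrefl {α : Type*} [LinearOrder α] (x : List α) : ¬ RadixLT x x := fun h => by
  have := (List.shortlex_iff_lex rfl).mp h
  exact irrefl _ this

theorem radixLT_trichotomous {α : Type*} [LinearOrder α] (x y : List α) :
    RadixLT x y ∨ x = y ∨ RadixLT y x :=
  trichotomous_of (List.Shortlex (· < ·)) x y

theorem RadixLT.length_le {α : Type*} [LinearOrder α] {x y : List α} (h : RadixLT x y) :
    x.length ≤ y.length := by
  rcases List.shortlex_def.mp h with h | h
  · exact h.le
  · exact h.1.le

theorem IsSuccessor.unique {α : Type*} [LinearOrder α] {L : Language α} {x y z : List α}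
    (hy : IsSuccessor L x y) (hz : IsSuccessor L x z) : y = z := by
  rcases radixLT_trichotomous y z with h | h | h
  · exact absurd hy.1 (hz.2.2 y hy.2.1 h)
  · exact h
  · exact absurd hz.1 (hy.2.2 z hz.2.1 h)

/-! ### Letterwise description of the successor -/

namespace DFA

variable {α σ : Type*} (M : DFA α σ)

/-- The states from which some word of length `k` is accepted. -/
def coreach (k : ℕ) : Set σ := reachIn (fun p q => ∃ a, M.step p a = q) M.accept k

/-- The states with a transition into `S`. -/
def preSet (S : Set σ) : Set σ := {p | ∃ a, M.step p a ∈ S}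

theorem coreach_zero : M.coreach 0 = M.accept := by
  ext p
  exact ⟨fun ⟨y, hy, h⟩ => (show p = y from h) ▸ hy, fun h => ⟨p, h, rfl⟩⟩

theorem coreach_succ (k : ℕ) : M.coreach (k + 1) = M.preSet (M.coreach k) := by
  ext p
  constructor
  · rintro ⟨y, hy, _, ⟨a, rfl⟩, h⟩
    exact ⟨a, y, hy, h⟩
  · rintro ⟨a, y, hy, h⟩
    exact ⟨y, hy, _, ⟨a, rfl⟩, h⟩

theorem mem_coreach {k : ℕ} {p : σ} :
    p ∈ M.coreach k ↔ ∃ w : List α, w.length = k ∧ M.evalFrom p w ∈ M.accept := by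
  induction k generalizing p with
  | zero =>
    rw [coreach_zero]
    exact ⟨fun h => ⟨[], rfl, h⟩, fun ⟨w, hw, h⟩ => by
      rw [List.length_eq_zero_iff] at hw
      subst hw
      exact h⟩
  | succ k ih =>
    rw [coreach_succ]
    constructor
    · rintro ⟨a, h⟩
      obtain ⟨w, hw, h⟩ := ih.mp h
      exact ⟨a :: w, by simp [hw], h⟩
    · rintro ⟨w, hw, h⟩
      obtain ⟨a, w, rfl⟩ := List.exists_cons_of_length_eq_add_one hw
      exact ⟨a, ih.mpr ⟨w, by simpa using hw, h⟩⟩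

section Successor

variable [LinearOrder α]

/-- `y` is the least word of its length that is accepted from `p`. -/
def IsLeastFrom (p : σ) (y : List α) : Prop :=
  M.evalFrom p y ∈ M.accept ∧
    ∀ z : List α, z.length = y.length → RadixLT z y → M.evalFrom p z ∉ M.accept

/-- No word that is larger than `x` and as long as `x` is accepted from `q`. -/
def NoneAbove (q : σ) (x : List α) : Prop :=
  ∀ z : List α, z.length = x.length → RadixLT x z → M.evalFrom q z ∉ M.accept

/-- `y` is the next word after `x` among those of its length that are accepted from `q`. -/
def IsNextFrom (q : σ) (x y : List α) : Prop :=
  RadixLT x y ∧ M.evalFrom q y ∈ M.accept ∧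
    ∀ z : List α, z.length = x.length → RadixLT x z → RadixLT z y → M.evalFrom q z ∉ M.accept

theorem isLeastFrom_cons {p : σ} {b : α} {y : List α} :
    M.IsLeastFrom p (b :: y) ↔
      (∀ c < b, M.step p c ∉ M.coreach y.length) ∧ M.IsLeastFrom (M.step p b) y := by
  constructor
  · rintro ⟨h1, h2⟩
    refine ⟨fun c hc hmem => ?_, h1, fun z hz hlt => ?_⟩
    · obtain ⟨w, hw, hacc⟩ := M.mem_coreach.mp hmem
      exact h2 (c :: w) (by simp [hw]) ((radixLT_cons_cons hw.symm).mpr (Or.inl hc)) hacc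
    · exact h2 (b :: z) (by simp [hz]) ((radixLT_cons_cons hz.symm).mpr (Or.inr ⟨rfl, hlt⟩))
  · rintro ⟨h1, h2, h3⟩
    refine ⟨h2, fun z hz hlt hacc => ?_⟩
    obtain ⟨c, z, rfl⟩ := List.exists_cons_of_length_eq_add_one hz
    have hz' : z.length = y.length := by simpa using hz
    rcases (radixLT_cons_cons hz'.symm).mp hlt with hc | ⟨rfl, hlt'⟩
    · exact h1 c hc (M.mem_coreach.mpr ⟨z, hz', hacc⟩)
    · exact h3 z hz' hlt' hacc

theorem noneAbove_cons {q : σ} {a : α} {x : List α} :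
    M.NoneAbove q (a :: x) ↔
      (∀ c, a < c → M.step q c ∉ M.coreach x.length) ∧ M.NoneAbove (M.step q a) x := by
  constructor
  · intro h
    refine ⟨fun c hc hmem => ?_, fun z hz hlt => ?_⟩
    · obtain ⟨w, hw, hacc⟩ := M.mem_coreach.mp hmem
      exact h (c :: w) (by simp [hw]) ((radixLT_cons_cons hw).mpr (Or.inl hc)) hacc
    · exact h (a :: z) (by simp [hz]) ((radixLT_cons_cons hz).mpr (Or.inr ⟨rfl, hlt⟩))
  · rintro ⟨h1, h2⟩ z hz hlt hacc
    obtain ⟨c, z, rfl⟩ := List.exists_cons_of_length_eq_add_one hz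
    have hz' : z.length = x.length := by simpa using hz
    rcases (radixLT_cons_cons hz').mp hlt with hc | ⟨rfl, hlt'⟩
    · exact h1 c hc (M.mem_coreach.mpr ⟨z, hz', hacc⟩)
    · exact h2 z hz' hlt' hacc

/-- Either the first letter is copied, or the words split here. `NoneAbove` says that no later split
would give a smaller accepted word above the input. -/
theorem isNextFrom_cons {q : σ} {a b : α} {x y : List α} (hlen : y.length = x.length) :
    M.IsNextFrom q (a :: x) (b :: y) ↔
      (b = a ∧ M.IsNextFrom (M.step q a) x y) ∨
      (a < b ∧ (∀ c, a < c → c < b → M.step q c ∉ M.coreach x.length) ∧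
        M.NoneAbove (M.step q a) x ∧ M.IsLeastFrom (M.step q b) y) := by
  constructor
  · rintro ⟨h1, h2, h3⟩
    rcases (radixLT_cons_cons hlen).mp h1 with hab | ⟨rfl, hxy⟩
    · refine Or.inr ⟨hab, fun c hac hcb hmem => ?_, fun z hz hlt => ?_, h2, fun z hz hlt => ?_⟩
      · obtain ⟨w, hw, hacc⟩ := M.mem_coreach.mp hmem
        exact h3 (c :: w) (by simp [hw]) ((radixLT_cons_cons hw).mpr (Or.inl hac))
          ((radixLT_cons_cons (hlen.trans hw.symm)).mpr (Or.inl hcb)) hacc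
      · exact h3 (a :: z) (by simp [hz]) ((radixLT_cons_cons hz).mpr (Or.inr ⟨rfl, hlt⟩))
          ((radixLT_cons_cons (hlen.trans hz.symm)).mpr (Or.inl hab))
      · exact h3 (b :: z) (by simp [hz, hlen]) ((radixLT_cons_cons (hz.trans hlen)).mpr (Or.inl hab))
          ((radixLT_cons_cons hz.symm).mpr (Or.inr ⟨rfl, hlt⟩))
    · refine Or.inl ⟨rfl, hxy, h2, fun z hz hxz hzy => ?_⟩
      exact h3 (a :: z) (by simp [hz]) ((radixLT_cons_cons hz).mpr (Or.inr ⟨rfl, hxz⟩))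
        ((radixLT_cons_cons (hlen.trans hz.symm)).mpr (Or.inr ⟨rfl, hzy⟩))
  · rintro (⟨rfl, h1, h2, h3⟩ | ⟨hab, h1, h2, h3, h4⟩)
    · refine ⟨(radixLT_cons_cons hlen).mpr (Or.inr ⟨rfl, h1⟩), h2, fun z hz hxz hzy hacc => ?_⟩
      obtain ⟨c, z, rfl⟩ := List.exists_cons_of_length_eq_add_one hz
      have hz' : z.length = x.length := by simpa using hz
      rcases (radixLT_cons_cons hz').mp hxz with hc | ⟨rfl, hxz'⟩
      · rcases (radixLT_cons_cons (hlen.trans hz'.symm)).mp hzy with hc' | ⟨rfl, -⟩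
        · exact lt_asymm hc hc'
        · exact lt_irrefl _ hc
      · rcases (radixLT_cons_cons (hlen.trans hz'.symm)).mp hzy with hc' | ⟨-, hzy'⟩
        · exact lt_irrefl _ hc'
        · exact h3 z hz' hxz' hzy' hacc
    · refine ⟨(radixLT_cons_cons hlen).mpr (Or.inl hab), h3, fun z hz hxz hzy hacc => ?_⟩
      obtain ⟨c, z, rfl⟩ := List.exists_cons_of_length_eq_add_one hz
      have hz' : z.length = x.length := by simpa using hz
      rcases (radixLT_cons_cons (hlen.trans hz'.symm)).mp hzy with hc' | ⟨rfl, hzy'⟩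
      · rcases (radixLT_cons_cons hz').mp hxz with hc | ⟨rfl, hxz'⟩
        · exact h1 c hc hc' (M.mem_coreach.mpr ⟨z, hz', hacc⟩)
        · exact h2 z hz' hxz' hacc
      · exact h4 z (hz'.trans hlen.symm) hzy' hacc

/-! ### The successor transducer and its runs -/

/-- The relation between the rest of the input and the rest of the output in a run of the successor
transducer: `q` is the state of `M` after the input so far, and `o` its state after the output
so far, or `none` if these are equal. -/
def IsCompletion (q : σ) : Option σ → List α → List α → Prop
  | none, x, y => y.length = x.length ∧ M.IsNextFrom q x y
  | some p, x, y => y.length = x.length ∧ M.NoneAbove q x ∧ M.IsLeastFrom p y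

/-- The condition for the successor transducer to read `a`, write `b` and replace `o` by `o'`,
where `S` is the guess for the set of states that can accept a word as long as the rest of the
input. -/
def SuccStep (q : σ) (a b : α) (o' : Option σ) (S : Set σ) : Option σ → Prop
  | none => (b = a ∧ o' = none) ∨
      (a < b ∧ (∀ c, a < c → c < b → M.step q c ∉ S) ∧ o' = some (M.step q b))
  | some p => (∀ c, a < c → M.step q c ∉ S) ∧ (∀ c < b, M.step p c ∉ S) ∧ o' = some (M.step p b)

theorem SuccStep.unique {M : DFA α σ} {q : σ} {a b : α} {o o₁ o₂ : Option σ} {S : Set σ}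
    (h₁ : M.SuccStep q a b o₁ S o) (h₂ : M.SuccStep q a b o₂ S o) : o₁ = o₂ := by
  cases o with
  | none =>
    rcases h₁ with ⟨rfl, rfl⟩ | ⟨hlt, -, rfl⟩ <;> rcases h₂ with ⟨h, rfl⟩ | ⟨hlt', -, rfl⟩
    · rfl
    · exact absurd hlt' (lt_irrefl _)
    · exact absurd hlt (h ▸ lt_irrefl _)
    · rfl
  | some p => exact h₁.2.2.trans h₂.2.2.symm

/-- The value `none` is excluded at the end because the successor is strictly larger than the input.
-/
theorem isCompletion_nil {q : σ} {o : Option σ} :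
    M.IsCompletion q o [] [] ↔ ∃ p ∈ M.accept, o = some p := by
  cases o with
  | none => simp [IsCompletion, IsNextFrom, radixLT_irrefl]
  | some p =>
    have h (z : List α) : ¬ RadixLT z [] := List.not_shortlex_nil_right
    have h' : M.NoneAbove q [] := fun z hz hlt => by
      rw [List.length_nil, List.length_eq_zero_iff] at hz
      exact absurd (hz ▸ hlt) (h _)
    simp [IsCompletion, IsLeastFrom, h, h']

theorem isCompletion_cons {q : σ} {o : Option σ} {a b : α} {x y : List α} :
    M.IsCompletion q o (a :: x) (b :: y) ↔
      ∃ o', M.SuccStep q a b o' (M.coreach x.length) o ∧ M.IsCompletion (M.step q a) o' x y := by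
  cases o with
  | none =>
    constructor
    · rintro ⟨hlen, h⟩
      have hlen' : y.length = x.length := by simpa using hlen
      rcases (M.isNextFrom_cons hlen').mp h with ⟨hba, h⟩ | ⟨hab, h1, h2, h3⟩
      · exact ⟨none, Or.inl ⟨hba, rfl⟩, hlen', h⟩
      · exact ⟨_, Or.inr ⟨hab, h1, rfl⟩, hlen', h2, h3⟩
    · rintro ⟨_, ⟨hba, rfl⟩ | ⟨hab, h1, rfl⟩, hlen, h⟩
      · exact ⟨by simp [hlen], (M.isNextFrom_cons hlen).mpr (Or.inl ⟨hba, h⟩)⟩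
      · exact ⟨by simp [hlen], (M.isNextFrom_cons hlen).mpr (Or.inr ⟨hab, h1, h⟩)⟩
  | some p =>
    constructor
    · rintro ⟨hlen, h1, h2⟩
      have hlen' : y.length = x.length := by simpa using hlen
      rw [noneAbove_cons] at h1
      rw [isLeastFrom_cons, hlen'] at h2
      exact ⟨_, ⟨h1.1, h2.1, rfl⟩, hlen', h1.2, h2.2⟩
    · rintro ⟨_, ⟨h1, h2, rfl⟩, hlen, h3, h4⟩
      exact ⟨by simp [hlen], M.noneAbove_cons.mpr ⟨h1, h3⟩,
        M.isLeastFrom_cons.mpr ⟨hlen.symm ▸ h2, h4⟩⟩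

/-- The transducer that maps every length-preserving word to its successor. Its states, apart from
the initial one, store the state of `M` after the input so far, its state after the output so far
once these differ, and the set of states that can accept a word as long as the rest of the
input. -/
def succTransducer : Transducer α α (Option (σ × Option σ × Set.range M.coreach)) where
  step
    | none, none => {t | ∃ S, t = (some (M.start, none, S), none)}
    | some s, some a => {t | ∃ b o' S', t = (some (M.step s.1 a, o', S'), some b) ∧
        s.2.2.1 = M.preSet S'.1 ∧ M.SuccStep s.1 a b o' S'.1 s.2.1}
    | _, _ => ∅
  start := none
  accept := {s | ∃ q S, ∃ p ∈ M.accept, S.1 = M.coreach 0 ∧ s = some (q, some p, S)}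

/-- `r` is a path of the successor transducer from `s` to an accepting state. -/
def IsSuccRun (s : Option (σ × Option σ × Set.range M.coreach))
    (r : List (Option α × Option α × Option (σ × Option σ × Set.range M.coreach))) : Prop :=
  ∃ e ∈ M.succTransducer.accept, M.succTransducer.IsPath s r e

variable {M}

/-- Induction from the end of the run: acceptance forces the last guess to be `coreach 0`, and each
transition carries correctness back to the preceding guess. -/
theorem IsSuccRun.isCompletion {q : σ} {o : Option σ} {S : Set.range M.coreach}
    {r : List (Option α × Option α × Option (σ × Option σ × Set.range M.coreach))}
    (h : M.IsSuccRun (some (q, o, S)) r) :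
    S.1 = M.coreach (Transducer.inputWord r).length ∧
      M.IsCompletion q o (Transducer.inputWord r) (Transducer.outputWord r) := by
  induction r generalizing q o S with
  | nil =>
    obtain ⟨e, ⟨q', S', p, hp, hS, rfl⟩, h⟩ := h
    obtain ⟨rfl, rfl, rfl⟩ : q = q' ∧ o = some p ∧ S = S' := by
      simpa [Transducer.IsPath] using h
    exact ⟨hS, M.isCompletion_nil.mpr ⟨p, hp, rfl⟩⟩
  | cons t r ih =>
    obtain ⟨e, he, ht, hr⟩ := h
    obtain ⟨_ | a, b', s⟩ := t
    · exact ht.elim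
    · obtain ⟨b, o', S', heq, hS, hstep⟩ := ht
      obtain ⟨rfl, rfl⟩ : s = _ ∧ b' = _ := Prod.ext_iff.mp heq
      obtain ⟨h1, h2⟩ := ih ⟨e, he, hr⟩
      simp only [h1] at hS hstep
      have hin : Transducer.inputWord ((some a, some b, some (M.step q a, o', S')) :: r) =
          a :: Transducer.inputWord r := rfl
      have hout : Transducer.outputWord ((some a, some b, some (M.step q a, o', S')) :: r) =
          b :: Transducer.outputWord r := rfl
      rw [hin, hout]
      exact ⟨hS.trans (M.coreach_succ _).symm, M.isCompletion_cons.mpr ⟨o', hstep, h2⟩⟩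

theorem IsCompletion.exists_run {q : σ} {o : Option σ} {x y : List α}
    (h : M.IsCompletion q o x y) :
    ∃ r, M.IsSuccRun (some (q, o, ⟨_, x.length, rfl⟩)) r ∧ Transducer.inputWord r = x ∧
      Transducer.outputWord r = y := by
  induction x generalizing q o y with
  | nil =>
    obtain rfl : y = [] := by
      cases o <;> exact List.length_eq_zero_iff.mp h.1
    obtain ⟨p, hp, rfl⟩ := M.isCompletion_nil.mp h
    exact ⟨[], ⟨_, ⟨q, _, p, hp, rfl, rfl⟩, rfl⟩, rfl, rfl⟩
  | cons a x ih =>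
    have hlen : y.length = x.length + 1 := by
      cases o <;> exact h.1
    obtain ⟨b, y, rfl⟩ := List.exists_cons_of_length_eq_add_one hlen
    obtain ⟨o', hstep, h⟩ := M.isCompletion_cons.mp h
    obtain ⟨r, ⟨e, he, hr⟩, hin, hout⟩ := ih h
    refine ⟨(some a, some b, some (M.step q a, o', ⟨_, x.length, rfl⟩)) :: r,
      ⟨e, he, ⟨b, o', _, rfl, M.coreach_succ _, hstep⟩, hr⟩, ?_, ?_⟩
    · exact congrArg (a :: ·) hin
    · exact congrArg (b :: ·) hout

theorem IsSuccRun.unique {q : σ} {o : Option σ} {S : Set.range M.coreach}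
    {r s : List (Option α × Option α × Option (σ × Option σ × Set.range M.coreach))}
    (hr : M.IsSuccRun (some (q, o, S)) r) (hs : M.IsSuccRun (some (q, o, S)) s)
    (hin : Transducer.inputWord r = Transducer.inputWord s)
    (hout : Transducer.outputWord r = Transducer.outputWord s) : r = s := by
  induction r generalizing q o S s with
  | nil =>
    obtain _ | ⟨⟨_ | a, b, t⟩, s⟩ := s
    · rfl
    · obtain ⟨e, he, ht, -⟩ := hs
      exact ht.elim
    · exact absurd hin (List.cons_ne_nil _ _).symm
  | cons t r ih =>
    obtain ⟨e, he, ht, hr⟩ := hr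
    obtain ⟨_ | a, b', t⟩ := t
    · exact ht.elim
    obtain ⟨b, o', S', heq, hS, hstep⟩ := ht
    obtain ⟨rfl, rfl⟩ : t = _ ∧ b' = _ := Prod.ext_iff.mp heq
    obtain _ | ⟨⟨_ | a₂, b₂', t₂⟩, s⟩ := s
    · exact absurd hin (List.cons_ne_nil _ _)
    · obtain ⟨e, he, ht, -⟩ := hs
      exact ht.elim
    obtain ⟨e₂, he₂, ⟨b₂, o₂', S₂', heq₂, hS₂, hstep₂⟩, hs⟩ := hs
    obtain ⟨rfl, rfl⟩ : t₂ = _ ∧ b₂' = _ := Prod.ext_iff.mp heq₂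
    obtain ⟨rfl, hin'⟩ := List.cons_eq_cons.mp
      (show a :: Transducer.inputWord r = a₂ :: Transducer.inputWord s from hin)
    obtain ⟨rfl, hout'⟩ := List.cons_eq_cons.mp
      (show b :: Transducer.outputWord r = b₂ :: Transducer.outputWord s from hout)
    have hr' : M.IsSuccRun _ r := ⟨e, he, hr⟩
    have hs' : M.IsSuccRun _ s := ⟨e₂, he₂, hs⟩
    -- Both guesses are correct for the same remaining length; after that, the letters `a` and `b`
    -- determine the next output state.
    obtain rfl : S' = S₂' := Subtype.ext <| by
      rw [hr'.isCompletion.1, hs'.isCompletion.1, hin']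
    obtain rfl := hstep.unique hstep₂
    rw [ih hr' hs' hin' hout']

theorem isAcceptingRun_succTransducer {x : List α}
    {r : List (Option α × Option α × Option (σ × Option σ × Set.range M.coreach))} :
    M.succTransducer.IsAcceptingRun x r ↔ ∃ S r', r = (none, none, some (M.start, none, S)) :: r' ∧
      M.IsSuccRun (some (M.start, none, S)) r' ∧ Transducer.inputWord r' = x := by
  constructor
  · rintro ⟨⟨e, he, h⟩, hx⟩
    obtain _ | ⟨⟨_ | a, b, t⟩, r⟩ := r
    · obtain ⟨q, S, p, hp, hS, rfl⟩ := he
      exact absurd h (Option.some_ne_none _).symm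
    · obtain ⟨⟨S, heq⟩, hr⟩ := h
      obtain ⟨rfl, rfl⟩ : t = _ ∧ b = _ := Prod.ext_iff.mp heq
      exact ⟨S, r, rfl, ⟨e, he, hr⟩, hx⟩
    · exact h.1.elim
  · rintro ⟨S, r', rfl, ⟨e, he, hr⟩, hx⟩
    exact ⟨⟨e, he, ⟨S, rfl⟩, hr⟩, hx⟩

/-- A word between two words of equal length in radix order has that length too, so longer and
shorter words cannot interfere. -/
theorem isCompletion_start_iff {x y : List α} :
    M.IsCompletion M.start none x y ↔ y.length = x.length ∧ IsSuccessor M.accepts x y := by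
  refine and_congr_right fun hlen => ⟨fun ⟨h1, h2, h3⟩ => ⟨h2, h1, fun z hxz hzy => ?_⟩,
    fun ⟨h1, h2, h3⟩ => ⟨h2, h1, fun z _ => h3 z⟩⟩
  exact h3 z (le_antisymm (hzy.length_le.trans hlen.le) hxz.length_le) hxz hzy

theorem transduces_succTransducer {x y : List α} :
    M.succTransducer.Transduces x y ↔ y.length = x.length ∧ IsSuccessor M.accepts x y := by
  rw [← isCompletion_start_iff]
  constructor
  · rintro ⟨r, hr, rfl⟩
    obtain ⟨S, r', rfl, hr', rfl⟩ := isAcceptingRun_succTransducer.mp hr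
    exact hr'.isCompletion.2
  · intro h
    obtain ⟨r, hr, hin, hout⟩ := h.exists_run
    exact ⟨_, isAcceptingRun_succTransducer.mpr ⟨_, r, rfl, hr, hin⟩, hout⟩

theorem succTransducer_unambiguous (M : DFA α σ) : M.succTransducer.Unambiguous := by
  intro x r s hr hs
  obtain ⟨S, r', rfl, hr', hrx⟩ := isAcceptingRun_succTransducer.mp hr
  obtain ⟨S₂, s', rfl, hs', hsx⟩ := isAcceptingRun_succTransducer.mp hs
  have h1 := hr'.isCompletion
  have h2 := hs'.isCompletion
  obtain rfl : S = S₂ := Subtype.ext (by rw [h1.1, h2.1, hrx, hsx])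
  rw [hrx] at h1
  rw [hsx] at h2
  rw [hr'.unique hs' (hrx.trans hsx.symm)
    ((isCompletion_start_iff.mp h1.2).2.unique (isCompletion_start_iff.mp h2.2).2)]

end Successor

end DFA

theorem IsSuccessor.isLengthPreserving {α : Type*} [LinearOrder α] {L : Language α} {x y : List α}
    (h : IsSuccessor L x y) (hlen : y.length = x.length) : IsLengthPreserving L x :=
  ⟨fun hmax => hmax ⟨y, h⟩, fun _ hz => h.unique hz ▸ hlen⟩

theorem mainTheorem5 :
    ∃ g : ℕ → ℝ,
      (g =O[atTop] fun n : ℕ => Real.sqrt ((n : ℝ) * Real.log (n : ℝ))) ∧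
      ∀ (α : Type u) [LinearOrder α] [Fintype α] (n : ℕ) (L : Language α),
        (∃ (σ : Type v) (_ : Fintype σ) (M : DFA α σ), Fintype.card σ = n ∧ M.accepts = L) →
        ∃ (Q : Type) (_ : Fintype Q) (T : Transducer α α Q),
          (Fintype.card Q : ℝ) ≤ (2 : ℝ) ^ g n ∧
          T.Unambiguous ∧
          (∀ x : List α, IsLengthIncreasing L x → ¬ T.Accepts x) ∧
          (∀ x y : List α, IsLengthPreserving L x → IsSuccessor L x y →
            ∀ z : List α, T.Transduces x z ↔ z = y) := by
  refine ⟨stateExponent, stateExponent_isBigO, ?_⟩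
  rintro α _ _ n L ⟨σ, _, M₀, rfl, rfl⟩
  -- Renaming the states by `Fin n` puts the state set of the transducer into `Type`, whatever the
  -- universe of `σ`.
  obtain ⟨M, hM⟩ : ∃ M : DFA α (Fin (Fintype.card σ)), M.accepts = M₀.accepts :=
    ⟨M₀.reindex (Fintype.equivFin σ), M₀.accepts_reindex _⟩
  rw [← hM]
  have : Nonempty (Fin (Fintype.card σ)) := ⟨M.start⟩
  have hfin : Fintype (Set.range M.coreach) := Fintype.ofFinite _
  refine ⟨_, inferInstance, M.succTransducer, ?_, M.succTransducer_unambiguous, ?_, ?_⟩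
  · have h := card_states_le (fun p q => ∃ a, M.step p a = q) M.accept
    rw [Fintype.card_fin] at h
    convert h using 2
    change _ = 1 + _ * (_ * Nat.card (Set.range M.coreach))
    rw [Nat.card_eq_fintype_card]
    simp [Fintype.card_option, Fintype.card_prod, add_comm]
  · rintro x hx ⟨r, hr⟩
    obtain ⟨hlen, hs⟩ := DFA.transduces_succTransducer.mp ⟨r, hr, rfl⟩
    exact hx (hs.isLengthPreserving hlen)
  · intro x y hx hy z
    rw [DFA.transduces_succTransducer]
    exact ⟨fun h => h.2.unique hy, fun h => h ▸ ⟨hx.2 y hy, hy⟩⟩
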